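/- Let $\mu$ be a compactly supported Radon measure on $\mathbb{R}^2$. For $t\in\mathbb{R}$, the horizontal slice $\mu_t$ of $\mu$ is the finite Borel measure on $\mathbb{R}^2$, unique when it exists, with $\operatorname{spt}\mu_t\subset\operatorname{spt}\mu\cap\{(x_1,x_2): x_2=t\}$ and $$\int\eta\,d\mu_t=\lim_{\delta\to0+}\frac1{2\delta}\int_{\{x\,:\,t-\delta<x_2<t+\delta\}}\eta\,d\mu\qquad\text{for all }\eta\in C(\mathbb{R}^2).$$ For $s>0$ and a finite Borel measure $\nu$ on $\mathbb{R}^2$ let $I_s(\nu)=\iint|x-y|^{-s}\,d\nu(x)\,d\nu(y)\in[0,\infty]$, where $|x-y|^{-s}=\infty$ if $x=y$, and let $\hat\mu(x)=\int e^{-ix\cdot y}\,d\mu(y)$. For every $1<d<2$ there is a finite constant $C_d>0$, depending only on $d$, such that for every compactly supported Radon measure $\mu$ on $\mathbb{R}^2$ the slice $\mu_t$ exists for Lebesgue almost every $t\in\mathbb{R}$, the (almost everywhere defined) function $t\mapsto I_{d-1}(\mu_t)$ is Lebesgue measurable, and $$\int_{\mathbb{R}}I_{d-1}(\mu_t)\,dt\le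 C_d\int_{\mathbb{R}^2}|x_1|^{d-2}|\hat\mu(x)|^2\,dx,$$ where both sides take values in $[0,\infty]$. -/

import Mathlib

open MeasureTheory Filter Topology
open scoped ENNReal NNReal

/-- The Euclidean plane `ℝ²`. -/
abbrev Plane : Type := EuclideanSpace ℝ (Fin 2)

/-- `ν` is the slice at height `t` of the measure `μ` with respect to the map `ρ : ℝ² → ℝ`:
`ν` is a finite Borel measure with `spt ν ⊆ spt μ ∩ ρ⁻¹{t}`, and
`∫ η dν = lim_{δ → 0+} (2δ)⁻¹ ∫_{ρ⁻¹(t - δ, t + δ)} η dμ` for every continuous `η : ℝ² → ℝ`. -/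
structure IsSlicedMeasure (μ : Measure Plane) (ρ : Plane → ℝ) (t : ℝ) (ν : Measure Plane) :
    Prop where
  isFiniteMeasure : IsFiniteMeasure ν
  support_subset : ν.support ⊆ μ.support ∩ ρ ⁻¹' {t}
  tendsto_integral : ∀ η : C(Plane, ℝ),
    Tendsto (fun δ : ℝ => (2 * δ)⁻¹ * ∫ x in ρ ⁻¹' Set.Ioo (t - δ) (t + δ), η x ∂μ)
      (𝓝[>] 0) (𝓝 (∫ x, η x ∂ν))

/-- There is at most one slice at each height. -/
theorem IsSlicedMeasure.unique {μ : Measure Plane} {ρ : Plane → ℝ} {t : ℝ}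
    {ν ν' : Measure Plane} (h : IsSlicedMeasure μ ρ t ν) (h' : IsSlicedMeasure μ ρ t ν') :
    ν = ν' := by
  have := h.isFiniteMeasure
  have := h'.isFiniteMeasure
  refine ext_of_forall_integral_eq_of_IsFiniteMeasure fun f => ?_
  exact tendsto_nhds_unique (h.tendsto_integral f.toContinuousMap)
    (h'.tendsto_integral f.toContinuousMap)

open Classical in
/-- The sliced measure `μ_{ρ,t}`, whenever it exists (and the zero measure otherwise). -/
noncomputable def slicedMeasure (μ : Measure Plane) (ρ : Plane → ℝ) (t : ℝ) : Measure Plane :=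
  if h : ∃ ν, IsSlicedMeasure μ ρ t ν then h.choose else 0

theorem IsSlicedMeasure.slicedMeasure_eq {μ : Measure Plane} {ρ : Plane → ℝ} {t : ℝ}
    {ν : Measure Plane} (h : IsSlicedMeasure μ ρ t ν) : slicedMeasure μ ρ t = ν := by
  have hex : ∃ ν, IsSlicedMeasure μ ρ t ν := ⟨ν, h⟩
  rw [slicedMeasure, dif_pos hex]
  exact hex.choose_spec.unique h

/-- The `s`-energy `I_s(ν) = ∬ |x - y|^{-s} dν(x) dν(y) ∈ [0, ∞]`; for `s > 0` the kernel is `∞`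
on the diagonal. -/
noncomputable def rieszEnergy (s : ℝ) (ν : Measure Plane) : ℝ≥0∞ :=
  ∫⁻ x, ∫⁻ y, edist x y ^ (-s) ∂ν ∂ν

/-- The Fourier transform `μ̂(x) = ∫ e^{-i x·y} dμ(y)` of a finite measure on `ℝ²`. -/
noncomputable def measureFourier (μ : Measure Plane) (x : Plane) : ℂ :=
  ∫ y, Complex.exp (-(Complex.I * (inner ℝ x y : ℝ))) ∂μ

/-! A slice sits on a horizontal line, so its `(d-1)`-energy is a one-dimensional energy. Writing
`|u|^{-s}` as a positive superposition of Gaussians, and each Gaussian as a Fourier transform of a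
positive Gaussian, turns that energy into a constant times `∫ |a|^{s-1} |μ̂_t(a)|² da`
(`line_energy_eq`), with `s = d - 1`. All weights are nonnegative, so Tonelli applies even when the
energy is infinite.

After integrating in `t` and exchanging integrals, it remains to bound `∫ |μ̂_t(a)|² dt` by `(2π)⁻¹
∫ |μ̂(a, b)|² db` for each `a`. The law of the height may be singular, so Plancherel is applied to
averages over strips of width `2δ`. Averaging multiplies the Fourier transform in `t` by a factor of
modulus at most 1, and Fatou then lets `δ → 0` (`lintegral_slice_fourier_sq_le`).

Existence of slices is Lebesgue differentiation: disintegrate `μ` over the height and multiply the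
conditional laws by the Lebesgue density of the height law (`ae_isSlicedMeasure_densitySlice`). -/

open scoped FourierTransform
open ProbabilityTheory

/-! ### Plancherel for integrable, square integrable functions on the line. -/

/-- The `L²` Fourier transform of an integrable function is given by the Fourier integral. -/
theorem fourier_toLp_ae_eq {f : ℝ → ℂ} (hf : Integrable f) (hf2 : MemLp f 2) :
    (𝓕 (hf2.toLp f) : Lp ℂ 2 (volume : Measure ℝ)) =ᵐ[volume] 𝓕 f := by
  have hloc : LocallyIntegrable (𝓕 (hf2.toLp f) : Lp ℂ 2 (volume : Measure ℝ)) volume :=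
    (Lp.memLp _).locallyIntegrable (by norm_num)
  have hcont : Continuous (𝓕 f) := VectorFourier.fourierIntegral_continuous
    Real.continuous_fourierChar (by fun_prop) hf
  -- Both sides are tested against smooth compactly supported `g`; on each side the transform can be
  -- moved onto `g`.
  refine ae_eq_of_integral_contDiff_smul_eq hloc hcont.locallyIntegrable fun g hg hgs => ?_
  have hgs' : HasCompactSupport (fun x => (g x : ℂ)) := hgs.comp_left Complex.ofReal_zero
  have hg' : ContDiff ℝ (↑(⊤ : ℕ∞)) (fun x => (g x : ℂ)) := Complex.ofRealCLM.contDiff.comp hg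
  set G : SchwartzMap ℝ ℂ := hgs'.toSchwartzMap hg' with hG
  have hGx : ∀ x, G x = (g x : ℂ) := fun x => rfl
  have h1 := congrArg (fun T => T G) (Lp.fourier_toTemperedDistribution_eq (hf2.toLp f))
  simp only [TemperedDistribution.fourier_apply, Lp.toTemperedDistribution_apply] at h1
  have h2 : ∫ x, g x • (𝓕 (hf2.toLp f) : Lp ℂ 2 (volume : Measure ℝ)) x
      = ∫ x, G x • (𝓕 (hf2.toLp f) : Lp ℂ 2 (volume : Measure ℝ)) x := by
    simp [hGx]
  rw [h2, ← h1]
  have h3 : ∫ x, (𝓕 G) x • (hf2.toLp f) x = ∫ x, (𝓕 (G : ℝ → ℂ)) x • f x := by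
    refine integral_congr_ae ?_
    filter_upwards [hf2.coeFn_toLp] with x hx
    rw [hx, SchwartzMap.fourier_coe]
  rw [h3]
  have h4 := VectorFourier.integral_fourierIntegral_smul_eq_flip (L := innerₗ ℝ) (μ := volume)
    (ν := volume) Real.continuous_fourierChar continuous_inner G.integrable hf
  rw [flip_innerₗ] at h4
  exact h4

theorem lintegral_enorm_fourier_sq {f : ℝ → ℂ} (hf : Integrable f) (hf2 : MemLp f 2) :
    ∫⁻ x, ‖𝓕 f x‖ₑ ^ 2 = ∫⁻ x, ‖f x‖ₑ ^ 2 := by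
  have key : ∀ g : ℝ → ℂ, eLpNorm g 2 volume ^ 2 = ∫⁻ x, ‖g x‖ₑ ^ 2 := fun g => by
    have := eLpNorm_nnreal_pow_eq_lintegral (f := g) (μ := volume) (p := 2) two_ne_zero
    simpa using this
  rw [← key, ← key, ← eLpNorm_congr_ae (fourier_toLp_ae_eq hf hf2),
    ← eLpNorm_congr_ae hf2.coeFn_toLp]
  have := Lp.norm_fourier_eq (hf2.toLp f)
  rw [Lp.norm_def, Lp.norm_def, ENNReal.toReal_eq_toReal_iff' (Lp.eLpNorm_ne_top _)
    (Lp.eLpNorm_ne_top _)] at this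
  rw [this]

/-! ### Gaussian representation of the Riesz kernel. -/

theorem lintegral_rpow_mul_exp_neg_mul_Ioi {a r : ℝ} (ha : 0 < a) (hr : 0 < r) :
    ∫⁻ t in Set.Ioi (0 : ℝ), ENNReal.ofReal (t ^ (a - 1) * Real.exp (-(r * t))) =
      ENNReal.ofReal ((1 / r) ^ a * Real.Gamma a) := by
  rw [← Real.integral_rpow_mul_exp_neg_mul_Ioi ha hr, ofReal_integral_eq_lintegral_ofReal]
  · have := integrableOn_rpow_mul_exp_neg_mul_rpow (s := a - 1) (p := 1) (by linarith) one_pos hr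
    simpa [IntegrableOn] using this
  · filter_upwards [ae_restrict_mem measurableSet_Ioi] with t ht
    have : (0 : ℝ) < t := ht
    positivity

/-- The substitution `t ↦ 1/t` reduces this to the usual Gamma integral. -/
theorem lintegral_rpow_mul_exp_neg_div_Ioi {a r : ℝ} (ha : 0 < a) (hr : 0 < r) :
    ∫⁻ t in Set.Ioi (0 : ℝ), ENNReal.ofReal (t ^ (-a - 1) * Real.exp (-(r / t))) =
      ENNReal.ofReal ((1 / r) ^ a * Real.Gamma a) := by
  set g : ℝ → ℝ := fun t => t ^ (a - 1) * Real.exp (-(r * t)) with hg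
  have hgi : IntegrableOn g (Set.Ioi 0) := by
    have := integrableOn_rpow_mul_exp_neg_mul_rpow (s := a - 1) (p := 1) (by linarith) one_pos hr
    simpa using this
  have hi := (integrableOn_Ioi_comp_rpow_iff g (p := -1) (by norm_num)).2 hgi
  have he := integral_comp_rpow_Ioi g (p := -1) (by norm_num)
  have hcongr : ∀ t ∈ Set.Ioi (0 : ℝ), (|(-1 : ℝ)| * t ^ ((-1 : ℝ) - 1)) • g (t ^ (-1 : ℝ)) =
      t ^ (-a - 1) * Real.exp (-(r / t)) := fun t ht => by
    have ht : (0 : ℝ) < t := ht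
    simp only [hg, abs_neg, abs_one, one_mul, smul_eq_mul]
    rw [← Real.rpow_mul ht.le, ← mul_assoc, ← Real.rpow_add ht, Real.rpow_neg_one, div_eq_mul_inv]
    congr 2
    ring
  rw [← Real.integral_rpow_mul_exp_neg_mul_Ioi ha hr, ← he, setIntegral_congr_fun measurableSet_Ioi
    hcongr, ofReal_integral_eq_lintegral_ofReal]
  · exact hi.congr_fun hcongr measurableSet_Ioi
  · filter_upwards [ae_restrict_mem measurableSet_Ioi] with t ht
    have : (0 : ℝ) < t := ht
    positivity

/-- The Gamma integral rescaled by `u²`. Including `u = 0`, where both sides are `∞`, makes it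
usable for measures charging the diagonal. -/
theorem enorm_rpow_neg_mul_Gamma {s : ℝ} (hs : 0 < s) (u : ℝ) :
    ‖u‖ₑ ^ (-s) * ENNReal.ofReal (Real.Gamma (s / 2)) =
      ∫⁻ r in Set.Ioi (0 : ℝ), ENNReal.ofReal (r ^ (s / 2 - 1) * Real.exp (-(u ^ 2 * r))) := by
  rcases eq_or_ne u 0 with rfl | hu
  · have h0 : ENNReal.ofReal (Real.Gamma (s / 2)) ≠ 0 := by
      simpa using Real.Gamma_pos_of_pos (half_pos hs)
    rw [enorm_zero, ENNReal.zero_rpow_of_neg (by linarith), ENNReal.top_mul h0]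
    -- At `u = 0` the integrand is a bare power, and no power is integrable on all of `(0, ∞)`.
    by_contra h
    refine not_integrableOn_Ioi_rpow (s / 2 - 1) ⟨by fun_prop, ?_⟩
    rw [hasFiniteIntegral_iff_ofReal]
    · refine lt_top_iff_ne_top.2 fun h' => h ?_
      simpa using h'.symm
    · filter_upwards [ae_restrict_mem measurableSet_Ioi] with t ht
      have : (0 : ℝ) < t := ht
      positivity
  · have hu2 : 0 < u ^ 2 := by positivity
    rw [lintegral_rpow_mul_exp_neg_mul_Ioi (half_pos hs) hu2, ENNReal.ofReal_mul (by positivity)]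
    congr 1
    rw [← ofReal_norm, ENNReal.ofReal_rpow_of_pos (by positivity), Real.norm_eq_abs,
      ← sq_abs, one_div, Real.inv_rpow (by positivity), ← Real.rpow_natCast, ← Real.rpow_mul
      (abs_nonneg u), Real.rpow_neg (abs_nonneg u)]
    congr 3
    push_cast
    ring

/-- Gives the Fourier-side weight: the factor `r^(-1/2)` shifts the exponent to `(1 - s)/2`,
positive exactly because `s < 1`. -/
theorem lintegral_gaussian_weight {s : ℝ} (hs : s < 1) {a : ℝ} (ha : a ≠ 0) :
    ∫⁻ r in Set.Ioi (0 : ℝ), ENNReal.ofReal (r ^ (s / 2 - 1) *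
        ((4 * Real.pi * r) ^ (-(1 / 2) : ℝ) * Real.exp (-(a ^ 2 / (4 * r))))) =
      ENNReal.ofReal ((4 * Real.pi) ^ (-(1 / 2) : ℝ) * 4 ^ ((1 - s) / 2) *
        Real.Gamma ((1 - s) / 2)) * ‖a‖ₑ ^ (s - 1) := by
  have h1 : ∀ r ∈ Set.Ioi (0 : ℝ), ENNReal.ofReal (r ^ (s / 2 - 1) *
        ((4 * Real.pi * r) ^ (-(1 / 2) : ℝ) * Real.exp (-(a ^ 2 / (4 * r))))) =
      ENNReal.ofReal ((4 * Real.pi) ^ (-(1 / 2) : ℝ)) *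
        ENNReal.ofReal (r ^ (-((1 - s) / 2) - 1) * Real.exp (-(a ^ 2 / 4 / r))) := fun r hr => by
    have hr : (0 : ℝ) < r := hr
    rw [← ENNReal.ofReal_mul (by positivity), Real.mul_rpow (by positivity) hr.le, div_div]
    congr 1
    rw [show (-((1 - s) / 2) - 1 : ℝ) = (s / 2 - 1) + (-(1 / 2)) by ring, Real.rpow_add hr]
    ring
  have ha2 : 0 < a ^ 2 / 4 := by positivity
  rw [setLIntegral_congr_fun measurableSet_Ioi h1, lintegral_const_mul' _ _ ENNReal.ofReal_ne_top,
    lintegral_rpow_mul_exp_neg_div_Ioi (by linarith) ha2, ← ofReal_norm,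
    ENNReal.ofReal_rpow_of_pos (by positivity), ← ENNReal.ofReal_mul (by positivity),
    ← ENNReal.ofReal_mul]
  · congr 1
    have : (1 / (a ^ 2 / 4)) ^ ((1 - s) / 2) = 4 ^ ((1 - s) / 2) * ‖a‖ ^ (s - 1) := by
      rw [one_div_div, Real.div_rpow (by norm_num) (by positivity), div_eq_mul_inv, ← Real.rpow_neg
        (by positivity), ← sq_abs, ← Real.rpow_natCast, ← Real.rpow_mul (abs_nonneg a),
        Real.norm_eq_abs]
      congr 2
      push_cast
      ring
    rw [this]
    ring
  · have : 0 < Real.Gamma ((1 - s) / 2) := Real.Gamma_pos_of_pos (by linarith)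
    positivity

theorem integral_gaussian_mul_cexp {r : ℝ} (hr : 0 < r) (u : ℝ) :
    ∫ a : ℝ, (((4 * Real.pi * r) ^ (-(1 / 2) : ℝ) * Real.exp (-(a ^ 2 / (4 * r))) : ℝ) : ℂ) *
      Complex.exp (-(Complex.I * ((a * u : ℝ) : ℂ))) = (Real.exp (-(u ^ 2 * r)) : ℝ) := by
  have hb : 0 < (((1 / (4 * r) : ℝ)) : ℂ).re := by
    rw [Complex.ofReal_re]; positivity
  have h := fourierIntegral_gaussian hb (-u)
  have h1 : ∀ a : ℝ, (((4 * Real.pi * r) ^ (-(1 / 2) : ℝ) * Real.exp (-(a ^ 2 / (4 * r))) : ℝ) : ℂ) *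
      Complex.exp (-(Complex.I * ((a * u : ℝ) : ℂ))) = (((4 * Real.pi * r) ^ (-(1 / 2) : ℝ) : ℝ) : ℂ) *
      (Complex.exp (Complex.I * (-u) * a) * Complex.exp (-((1 / (4 * r) : ℝ) : ℂ) * a ^ 2)) :=
    fun a => by
      have e1 : Complex.I * (-u) * a = -(Complex.I * ((a * u : ℝ) : ℂ)) := by push_cast; ring
      have e2 : -((1 / (4 * r) : ℝ) : ℂ) * a ^ 2 = ((-(a ^ 2 / (4 * r)) : ℝ) : ℂ) := by
        push_cast; ring
      rw [e1, e2, Complex.ofReal_mul, Complex.ofReal_exp]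
      ring
  have h2 : ((Real.pi : ℂ) / ((1 / (4 * r) : ℝ) : ℂ)) ^ (1 / 2 : ℂ) =
      (((4 * Real.pi * r) ^ (1 / 2 : ℝ) : ℝ) : ℂ) := by
    rw [Complex.ofReal_cpow (by positivity)]
    congr 1
    · push_cast; field_simp
    · push_cast; rfl
  simp_rw [h1]
  rw [integral_const_mul, h, h2, ← mul_assoc, ← Complex.ofReal_mul, ← Real.rpow_add (by positivity)]
  have hr' : (r : ℂ) ≠ 0 := by exact_mod_cast hr.ne'
  simp only [neg_add_cancel, Real.rpow_zero, Complex.ofReal_one, one_mul, Complex.ofReal_exp]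
  congr 1
  push_cast
  field_simp

/-! ### Riesz energy on the line through the Fourier transform. -/

/-- The one-dimensional Fourier transform of a finite measure on the line. -/
noncomputable def lineFourier (lam : Measure ℝ) (a : ℝ) : ℂ :=
  ∫ u, Complex.exp (-(Complex.I * ((a * u : ℝ) : ℂ))) ∂lam

theorem norm_cexp_neg_I_mul (u : ℝ) : ‖Complex.exp (-(Complex.I * (u : ℂ)))‖ = 1 := by
  rw [← mul_neg, mul_comm, ← Complex.ofReal_neg, Complex.norm_exp_ofReal_mul_I]

theorem measurable_lineFourier (lam : Measure ℝ) [SFinite lam] : Measurable (lineFourier lam) := by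
  refine StronglyMeasurable.measurable (StronglyMeasurable.integral_prod_right' (f := fun p : ℝ × ℝ =>
    Complex.exp (-(Complex.I * ((p.1 * p.2 : ℝ) : ℂ)))) ?_)
  exact Continuous.stronglyMeasurable (by fun_prop)

/-- Expanding the Gaussian in `x - y` as a Fourier integral, the phase splits into a function of `x`
times the conjugate of the same function of `y`, so Fubini produces a squared modulus. -/
theorem lintegral_lintegral_gaussian (lam : Measure ℝ) [IsFiniteMeasure lam] {r : ℝ} (hr : 0 < r) :
    ∫⁻ x, ∫⁻ y, ENNReal.ofReal (Real.exp (-((x - y) ^ 2 * r))) ∂lam ∂lam =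
      ∫⁻ a : ℝ, ENNReal.ofReal ((4 * Real.pi * r) ^ (-(1 / 2) : ℝ) *
        Real.exp (-(a ^ 2 / (4 * r)))) * ‖lineFourier lam a‖ₑ ^ 2 := by
  set G : ℝ → ℝ := fun a => (4 * Real.pi * r) ^ (-(1 / 2) : ℝ) * Real.exp (-(a ^ 2 / (4 * r))) with hG
  have hGc : Continuous G := by fun_prop
  have hG0 : ∀ a, 0 ≤ G a := fun a => by positivity
  have hGi : Integrable G := by
    have := integrable_exp_neg_mul_sq (b := 1 / (4 * r)) (by positivity)
    refine (this.congr (.of_forall fun a => ?_)).const_mul _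
    simp only
    congr 1
    ring
  set e : ℝ → ℂ := fun u => Complex.exp (-(Complex.I * (u : ℂ))) with he
  have hec : Continuous e := by fun_prop
  have hen : ∀ u, ‖e u‖ = 1 := norm_cexp_neg_I_mul
  have hexp_int : Integrable (fun p : ℝ × ℝ => Real.exp (-((p.1 - p.2) ^ 2 * r))) (lam.prod lam) := by
    refine Integrable.of_bound (C := 1) (by fun_prop) (.of_forall fun p => ?_)
    rw [Real.norm_eq_abs, abs_of_pos (Real.exp_pos _), Real.exp_le_one_iff]
    have : 0 ≤ (p.1 - p.2) ^ 2 * r := by positivity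
    linarith
  have hmain : (∫ p : ℝ × ℝ, Real.exp (-((p.1 - p.2) ^ 2 * r)) ∂lam.prod lam : ℝ) =
      ∫ a, G a * ‖lineFourier lam a‖ ^ 2 := by
    apply Complex.ofReal_injective
    rw [← integral_complex_ofReal, ← integral_complex_ofReal]
    have h1 : ∀ p : ℝ × ℝ, ((Real.exp (-((p.1 - p.2) ^ 2 * r)) : ℝ) : ℂ) =
        ∫ a, (G a : ℂ) * e (a * (p.1 - p.2)) := fun p => (integral_gaussian_mul_cexp hr _).symm
    simp_rw [h1]
    rw [integral_integral_swap]
    · refine integral_congr_ae (.of_forall fun a => ?_)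
      simp only
      rw [integral_const_mul]
      have h2 : ∀ p : ℝ × ℝ, e (a * (p.1 - p.2)) = e (a * p.1) * (starRingEnd ℂ) (e (a * p.2)) :=
        fun p => by
          simp only [he]
          rw [← Complex.exp_conj, ← Complex.exp_add]
          congr 1
          simp
          ring
      simp_rw [h2]
      rw [integral_prod_mul (fun x => e (a * x)) (fun y => (starRingEnd ℂ) (e (a * y))),
        integral_conj]
      change (G a : ℂ) * (lineFourier lam a * (starRingEnd ℂ) (lineFourier lam a)) = _
      rw [Complex.mul_conj, Complex.normSq_eq_norm_sq]
      push_cast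
      rfl
    · refine Integrable.mono' (g := fun z => G z.2) (hGi.comp_snd _) ?_ (.of_forall fun z => ?_)
      · exact Continuous.aestronglyMeasurable (by unfold Function.uncurry; fun_prop)
      · simp [Function.uncurry, hen, abs_of_nonneg (hG0 _)]
  rw [← lintegral_prod (fun p : ℝ × ℝ => ENNReal.ofReal (Real.exp (-((p.1 - p.2) ^ 2 * r))))
    (by fun_prop), ← ofReal_integral_eq_lintegral_ofReal hexp_int
      (.of_forall fun p => (Real.exp_pos _).le), hmain]
  have hbound : ∀ a, ‖lineFourier lam a‖ ≤ lam.real Set.univ := fun a => by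
    refine (norm_integral_le_of_norm_le_const (.of_forall fun u => (hen _).le)).trans ?_
    simp
  rw [ofReal_integral_eq_lintegral_ofReal]
  · refine lintegral_congr fun a => ?_
    rw [ENNReal.ofReal_mul (hG0 a), ENNReal.ofReal_pow (norm_nonneg _), ofReal_norm]
  · refine hGi.mul_bdd (c := lam.real Set.univ ^ 2)
      ((measurable_lineFourier lam).norm.pow_const 2).aestronglyMeasurable (.of_forall fun a => ?_)
    rw [norm_pow, norm_norm]
    exact pow_le_pow_left₀ (norm_nonneg _) (hbound a) 2
  · exact .of_forall fun a => mul_nonneg (hG0 a) (by positivity)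

/-- The Riesz energy of a finite measure on the line in terms of its Fourier transform. -/
theorem line_energy_eq {s : ℝ} (hs0 : 0 < s) (hs1 : s < 1) (lam : Measure ℝ) [IsFiniteMeasure lam] :
    (∫⁻ x, ∫⁻ y, ‖x - y‖ₑ ^ (-s) ∂lam ∂lam) * ENNReal.ofReal (Real.Gamma (s / 2)) =
      ENNReal.ofReal ((4 * Real.pi) ^ (-(1 / 2) : ℝ) * 4 ^ ((1 - s) / 2) *
        Real.Gamma ((1 - s) / 2)) *
      ∫⁻ a : ℝ, ‖a‖ₑ ^ (s - 1) * ‖lineFourier lam a‖ₑ ^ 2 := by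
  have hms := measurable_lineFourier lam
  have hm : Measurable fun p : ℝ × ℝ => ‖p.1 - p.2‖ₑ ^ (-s) := by fun_prop
  calc _ = ∫⁻ p : ℝ × ℝ, ‖p.1 - p.2‖ₑ ^ (-s) * ENNReal.ofReal (Real.Gamma (s / 2)) ∂lam.prod lam := by
        rw [← lintegral_prod (fun p : ℝ × ℝ => ‖p.1 - p.2‖ₑ ^ (-s)) hm.aemeasurable,
          lintegral_mul_const _ hm]
    _ = ∫⁻ p : ℝ × ℝ, (∫⁻ r in Set.Ioi (0 : ℝ), ENNReal.ofReal (r ^ (s / 2 - 1) *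
          Real.exp (-((p.1 - p.2) ^ 2 * r)))) ∂lam.prod lam := by
        simp_rw [enorm_rpow_neg_mul_Gamma hs0]
    _ = ∫⁻ r in Set.Ioi (0 : ℝ), ∫⁻ p : ℝ × ℝ, ENNReal.ofReal (r ^ (s / 2 - 1) *
          Real.exp (-((p.1 - p.2) ^ 2 * r))) ∂lam.prod lam := by
        rw [lintegral_lintegral_swap]
        unfold Function.uncurry
        fun_prop
    _ = ∫⁻ r in Set.Ioi (0 : ℝ), ∫⁻ a : ℝ, ENNReal.ofReal (r ^ (s / 2 - 1) *
        ((4 * Real.pi * r) ^ (-(1 / 2) : ℝ) * Real.exp (-(a ^ 2 / (4 * r))))) *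
          ‖lineFourier lam a‖ₑ ^ 2 := by
        refine setLIntegral_congr_fun measurableSet_Ioi fun r hr => ?_
        have hr : (0 : ℝ) < r := hr
        have hr' : (0 : ℝ) ≤ r ^ (s / 2 - 1) := by positivity
        simp_rw [ENNReal.ofReal_mul hr', mul_assoc]
        rw [lintegral_const_mul' _ _ ENNReal.ofReal_ne_top,
          lintegral_const_mul' _ _ ENNReal.ofReal_ne_top,
          lintegral_prod (fun p : ℝ × ℝ => ENNReal.ofReal (Real.exp (-((p.1 - p.2) ^ 2 * r))))
            (by fun_prop), lintegral_lintegral_gaussian lam hr]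
        simp_rw [mul_assoc]
    _ = ∫⁻ a : ℝ, ∫⁻ r in Set.Ioi (0 : ℝ), ENNReal.ofReal (r ^ (s / 2 - 1) *
        ((4 * Real.pi * r) ^ (-(1 / 2) : ℝ) * Real.exp (-(a ^ 2 / (4 * r))))) *
          ‖lineFourier lam a‖ₑ ^ 2 := by
        rw [lintegral_lintegral_swap]
        unfold Function.uncurry
        fun_prop
    _ = _ := by
        rw [← lintegral_const_mul' _ _ ENNReal.ofReal_ne_top]
        refine lintegral_congr_ae ?_
        filter_upwards [Measure.ae_ne volume (0 : ℝ)] with a ha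
        rw [lintegral_mul_const _ (by fun_prop), lintegral_gaussian_weight hs1 ha, mul_assoc]

/-! ### Differentiation and disintegration along the height. -/

/-- Differentiation of finite measures on the line along symmetric open intervals. -/
theorem ae_tendsto_rnDeriv_Ioo (m : Measure ℝ) [IsFiniteMeasure m] :
    ∀ᵐ t : ℝ, Tendsto (fun δ : ℝ => m (Set.Ioo (t - δ) (t + δ)) / ENNReal.ofReal (2 * δ)) (𝓝[>] 0)
      (𝓝 (m.rnDeriv volume t)) := by
  filter_upwards [Besicovitch.ae_tendsto_rnDeriv m volume] with t ht
  -- The Besicovitch theorem concerns closed balls. An open interval is an increasing union of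
  -- closed ones, so its quotient is a limit of theirs and stays in any closed neighbourhood
  -- containing them.
  refine (closed_nhds_basis _).tendsto_right_iff.2 fun U hU => ?_
  obtain ⟨δ₀, hδ₀, h⟩ := mem_nhdsGT_iff_exists_Ioo_subset.1 (ht hU.1)
  have hδ₀ : (0 : ℝ) < δ₀ := hδ₀
  filter_upwards [Ioo_mem_nhdsGT hδ₀] with δ hδ
  have hunion : Set.Ioo (t - δ) (t + δ) = ⋃ n : ℕ, Metric.closedBall t (δ - δ / (n + 2)) := by
    ext x
    simp only [Set.mem_iUnion, Metric.mem_closedBall, Real.dist_eq, ← Real.ball_eq_Ioo,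
      Metric.mem_ball]
    constructor
    · intro hx
      obtain ⟨n, hn⟩ := exists_nat_gt (δ / (δ - |x - t|))
      refine ⟨n, ?_⟩
      have h1 : 0 < δ - |x - t| := by linarith
      rw [div_lt_iff₀ h1] at hn
      have : δ / (n + 2) ≤ δ - |x - t| := by
        rw [div_le_iff₀ (by positivity)]
        nlinarith
      linarith
    · rintro ⟨n, hn⟩
      have : 0 < δ / (n + 2) := div_pos hδ.1 (by positivity)
      linarith
  have hmono : Monotone fun n : ℕ => Metric.closedBall t (δ - δ / (n + 2)) := fun a b hab => by
    refine Metric.closedBall_subset_closedBall ?_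
    have h1 : (a : ℝ) ≤ b := by exact_mod_cast hab
    have := hδ.1
    gcongr
  have hr : Tendsto (fun n : ℕ => δ - δ / ((n : ℝ) + 2)) atTop (𝓝 δ) := by
    have : Tendsto (fun n : ℕ => δ / ((n : ℝ) + 2)) atTop (𝓝 0) :=
      tendsto_const_nhds.div_atTop
        (tendsto_atTop_add_const_right _ _ tendsto_natCast_atTop_atTop)
    simpa using tendsto_const_nhds.sub this
  have hlim : Tendsto (fun n : ℕ => m (Metric.closedBall t (δ - δ / (n + 2))) /
      ENNReal.ofReal (2 * (δ - δ / (n + 2)))) atTop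
      (𝓝 (m (Set.Ioo (t - δ) (t + δ)) / ENNReal.ofReal (2 * δ))) := by
    rw [hunion]
    refine ENNReal.Tendsto.div (tendsto_measure_iUnion_atTop hmono) (.inr ?_)
      (ENNReal.tendsto_ofReal (hr.const_mul 2)) (.inr (measure_ne_top _ _))
    simpa using hδ.1
  refine hU.2.mem_of_tendsto hlim (.of_forall fun n => ?_)
  have h2 : δ / ((n : ℝ) + 2) < δ := div_lt_self hδ.1 (by linarith [n.cast_nonneg (α := ℝ)])
  have h3 : 0 < δ / ((n : ℝ) + 2) := div_pos hδ.1 (by positivity)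
  have := @h (δ - δ / (n + 2)) ⟨by linarith, by linarith [hδ.2]⟩
  simpa [Real.volume_closedBall] using this

/-- The joint law of `(ρ(x), x)` with `ρ(x) = x₁`. -/
noncomputable def graphMeasure (μ : Measure Plane) : Measure (ℝ × Plane) :=
  μ.map fun x => (x 1, x)

instance (μ : Measure Plane) [IsFiniteMeasure μ] : IsFiniteMeasure (graphMeasure μ) := by
  unfold graphMeasure; infer_instance

/-- The conditional laws of `μ` given the height. -/
noncomputable def heightKernel (μ : Measure Plane) [IsFiniteMeasure μ] : Kernel ℝ Plane :=
  (graphMeasure μ).condKernel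

instance (μ : Measure Plane) [IsFiniteMeasure μ] : IsMarkovKernel (heightKernel μ) := by
  unfold heightKernel; infer_instance

/-- The density of the absolutely continuous part of the law of the height. -/
noncomputable def heightDensity (μ : Measure Plane) : ℝ → ℝ≥0∞ :=
  (graphMeasure μ).fst.rnDeriv volume

theorem measurable_heightDensity (μ : Measure Plane) : Measurable (heightDensity μ) :=
  Measure.measurable_rnDeriv _ _

/-- The disintegration measures with respect to Lebesgue measure. -/
noncomputable def densitySlice (μ : Measure Plane) [IsFiniteMeasure μ] (t : ℝ) : Measure Plane :=
  heightDensity μ t • heightKernel μ t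

theorem graphMeasure_eq_compProd (μ : Measure Plane) [IsFiniteMeasure μ] :
    (graphMeasure μ).fst ⊗ₘ heightKernel μ = graphMeasure μ :=
  (graphMeasure μ).disintegrate (graphMeasure μ).condKernel

theorem setLIntegral_height (μ : Measure Plane) [IsFiniteMeasure μ] {g : Plane → ℝ≥0∞}
    (hg : Measurable g) {A : Set ℝ} (hA : MeasurableSet A) :
    ∫⁻ x in (fun x : Plane => x 1) ⁻¹' A, g x ∂μ =
      ∫⁻ t in A, ∫⁻ x, g x ∂heightKernel μ t ∂(graphMeasure μ).fst := by
  have hm : Measurable fun x : Plane => (x 1, x) := by fun_prop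
  have hg' : Measurable fun p : ℝ × Plane => A.indicator (fun _ => g p.2) p.1 := by
    have : (fun p : ℝ × Plane => A.indicator (fun _ => g p.2) p.1) =
        (Prod.fst ⁻¹' A).indicator fun p => g p.2 := by
      ext p; rfl
    rw [this]
    exact (hg.comp measurable_snd).indicator (measurable_fst hA)
  have h1 : ∫⁻ p, A.indicator (fun _ => g p.2) p.1 ∂graphMeasure μ =
      ∫⁻ x in (fun x : Plane => x 1) ⁻¹' A, g x ∂μ := by
    rw [graphMeasure, lintegral_map hg' hm, ← lintegral_indicator ((by fun_prop : Measurable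
      fun x : Plane => x 1) hA)]
    rfl
  rw [← h1, ← graphMeasure_eq_compProd, Measure.lintegral_compProd hg', ← lintegral_indicator hA,
    graphMeasure_eq_compProd]
  refine lintegral_congr fun t => ?_
  by_cases ht : t ∈ A <;> simp [ht]

/-- The absolutely continuous part is dominated by the height law. This transfers facts about the
conditional laws to Lebesgue-a.e. `t`; where the density vanishes the slice is zero anyway. -/
theorem ae_heightDensity_of_ae {μ : Measure Plane} {p : ℝ → Prop}
    (h : ∀ᵐ t ∂(graphMeasure μ).fst, p t) : ∀ᵐ t : ℝ, heightDensity μ t ≠ 0 → p t :=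
  (ae_withDensity_iff (measurable_heightDensity μ)).1
    (ae_mono (Measure.withDensity_rnDeriv_le _ _) h)

theorem ae_densitySlice_mem (μ : Measure Plane) [IsFiniteMeasure μ] {K : Set Plane}
    (hK : MeasurableSet K) (hμK : μ Kᶜ = 0) :
    ∀ᵐ t : ℝ, ∀ᵐ x ∂densitySlice μ t, x ∈ K ∧ x 1 = t := by
  have hm : Measurable fun x : Plane => (x 1, x) := by fun_prop
  have h1 : ∀ᵐ p ∂graphMeasure μ, p.2 ∈ K ∧ p.2 1 = p.1 := by
    refine (ae_map_iff hm.aemeasurable ?_).2 ?_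
    · exact (measurable_snd hK).inter (measurableSet_eq_fun (by fun_prop) (by fun_prop))
    · filter_upwards [measure_eq_zero_iff_ae_notMem.1 hμK] with x hx
      exact ⟨not_not.1 hx, rfl⟩
  rw [← graphMeasure_eq_compProd] at h1
  filter_upwards [ae_heightDensity_of_ae (Measure.ae_ae_of_ae_compProd h1)] with t ht
  rcases eq_or_ne (heightDensity μ t) 0 with h0 | h0
  · simp [densitySlice, h0]
  · exact Measure.ae_smul_measure (ht h0) _

/-- Weighting the height law by the fibre integrals of `g` turns strip integrals into masses of
intervals, whose derivative is the fibre integral times the height density. -/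
theorem ae_tendsto_lintegral_strip (μ : Measure Plane) [IsFiniteMeasure μ] {g : Plane → ℝ≥0∞}
    (hg : Measurable g) (hgi : ∫⁻ x, g x ∂μ ≠ ∞) :
    ∀ᵐ t : ℝ, Tendsto (fun δ : ℝ => (∫⁻ x in (fun x : Plane => x 1) ⁻¹' Set.Ioo (t - δ) (t + δ),
      g x ∂μ) / ENNReal.ofReal (2 * δ)) (𝓝[>] 0) (𝓝 (∫⁻ x, g x ∂densitySlice μ t)) := by
  set G : ℝ → ℝ≥0∞ := fun t => ∫⁻ x, g x ∂heightKernel μ t with hG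
  have hGm : Measurable G := hg.lintegral_kernel
  have hGi : ∫⁻ t, G t ∂(graphMeasure μ).fst ≠ ∞ := by
    have := setLIntegral_height μ hg MeasurableSet.univ
    simp only [Set.preimage_univ, Measure.restrict_univ] at this
    rwa [← this]
  have : IsFiniteMeasure ((graphMeasure μ).fst.withDensity G) := isFiniteMeasure_withDensity hGi
  filter_upwards [ae_tendsto_rnDeriv_Ioo ((graphMeasure μ).fst.withDensity G),
    Measure.rnDeriv_withDensity_left (μ := (graphMeasure μ).fst) (ν := volume) hGm.aemeasurable
      ((ae_lt_top hGm hGi).mono fun _ h => h.ne)] with t ht ht'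
  rw [ht'] at ht
  simp_rw [setLIntegral_height μ hg measurableSet_Ioo]
  simp_rw [withDensity_apply _ measurableSet_Ioo] at ht
  rw [densitySlice, lintegral_smul_measure, smul_eq_mul, mul_comm]
  exact ht

theorem isFiniteMeasure_of_isCompact_support (μ : Measure Plane) [μ.Regular]
    (h : IsCompact μ.support) : IsFiniteMeasure μ := by
  refine ⟨?_⟩
  rw [← measure_add_measure_compl (μ := μ) h.measurableSet, Measure.measure_compl_support, add_zero]
  exact h.measure_lt_top

theorem Continuous.integrable_of_ae_mem_isCompact {η : Plane → ℝ} (hη : Continuous η)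
    {ν : Measure Plane} [IsFiniteMeasure ν] {K : Set Plane} (hK : IsCompact K)
    (h : ∀ᵐ x ∂ν, x ∈ K) : Integrable η ν := by
  obtain ⟨C, hC⟩ := hK.exists_bound_of_continuousOn hη.continuousOn
  exact Integrable.of_bound hη.aestronglyMeasurable C (h.mono hC)

theorem ae_tendsto_integral_strip (μ : Measure Plane) [IsFiniteMeasure μ] {K : Set Plane}
    (hK : IsCompact K) (hμK : μ Kᶜ = 0) (η : C(Plane, ℝ)) :
    ∀ᵐ t : ℝ, Tendsto (fun δ : ℝ => (2 * δ)⁻¹ *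
      ∫ x in (fun x : Plane => x 1) ⁻¹' Set.Ioo (t - δ) (t + δ), η x ∂μ) (𝓝[>] 0)
      (𝓝 (∫ x, η x ∂densitySlice μ t)) := by
  have hμK' : ∀ᵐ x ∂μ, x ∈ K := (measure_eq_zero_iff_ae_notMem.1 hμK).mono fun x hx => not_not.1 hx
  have hint : Integrable η μ := η.continuous.integrable_of_ae_mem_isCompact hK hμK'
  have hp : Measurable fun x : Plane => ENNReal.ofReal (η x) := by fun_prop
  have hn : Measurable fun x : Plane => ENNReal.ofReal (-η x) := by fun_prop
  filter_upwards [ae_tendsto_lintegral_strip μ hp hint.lintegral_lt_top.ne,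
    ae_tendsto_lintegral_strip μ hn hint.neg.lintegral_lt_top.ne,
    ae_densitySlice_mem μ hK.measurableSet hμK,
    Measure.rnDeriv_lt_top (graphMeasure μ).fst volume] with t h1 h2 h3 h4
  have : IsFiniteMeasure (densitySlice μ t) := by
    refine ⟨?_⟩
    simpa [densitySlice, heightDensity] using h4
  have hint' : Integrable η (densitySlice μ t) :=
    η.continuous.integrable_of_ae_mem_isCompact hK (h3.mono fun x hx => hx.1)
  rw [integral_eq_lintegral_pos_part_sub_lintegral_neg_part hint']
  refine (((ENNReal.tendsto_toReal hint'.lintegral_lt_top.ne).comp h1).sub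
    ((ENNReal.tendsto_toReal hint'.neg.lintegral_lt_top.ne).comp h2)).congr' ?_
  filter_upwards [self_mem_nhdsWithin] with δ hδ
  have hδ : (0 : ℝ) < δ := hδ
  simp only [Function.comp, ENNReal.toReal_div]
  rw [integral_eq_lintegral_pos_part_sub_lintegral_neg_part hint.integrableOn,
    ENNReal.toReal_ofReal (by positivity)]
  ring

/-! ### Existence of slices. -/

/-- For almost every height the slice exists and is given by the disintegration. -/
theorem ae_isSlicedMeasure_densitySlice (μ : Measure Plane) [IsFiniteMeasure μ]
    (hK : IsCompact μ.support) :
    ∀ᵐ t : ℝ, IsSlicedMeasure μ (fun x => x 1) t (densitySlice μ t) := by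
  have hμK : μ μ.supportᶜ = 0 := Measure.measure_compl_support
  have hμK' : ∀ᵐ x ∂μ, x ∈ μ.support := Measure.support_mem_ae
  -- The exceptional null set depends on the test function, so only a countable dense family and the
  -- constant 1 are used. Density for uniform convergence on the compact support suffices.
  filter_upwards [ae_all_iff.2 fun n : ℕ => ae_tendsto_integral_strip μ hK hμK
      (TopologicalSpace.denseSeq C(Plane, ℝ) n), ae_tendsto_integral_strip μ hK hμK 1,
    ae_densitySlice_mem μ hK.measurableSet hμK,
    Measure.rnDeriv_lt_top (graphMeasure μ).fst volume] with t h1 h2 h3 h4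
  have hfin : IsFiniteMeasure (densitySlice μ t) := by
    refine ⟨?_⟩
    simpa [densitySlice, heightDensity] using h4
  refine ⟨hfin, ?_, fun η => ?_⟩
  · exact Measure.support_subset_of_isClosed
      (hK.isClosed.inter (isClosed_eq (by fun_prop) continuous_const)) h3
  set N : ℝ := (densitySlice μ t).real Set.univ with hN
  have hN0 : 0 ≤ N := measureReal_nonneg
  have hone : ∀ (m : Measure Plane), ∫ x, (1 : C(Plane, ℝ)) x ∂m = m.real Set.univ := fun m => by
    simp
  simp only [hone, ← hN] at h2
  rw [Metric.tendsto_nhds]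
  intro ε hε
  -- Strip masses over `2δ` are eventually below `N + 1`, so each replacement of `η` by the
  -- approximant costs at most `ε/4`; the `+ 1` also covers `N = 0`.
  set ε' : ℝ := ε / (4 * (N + 1)) with hε'
  have hε'0 : 0 < ε' := by positivity
  obtain ⟨n, hn⟩ : ∃ n, ∀ x ∈ μ.support,
      |η x - TopologicalSpace.denseSeq C(Plane, ℝ) n x| ≤ ε' := by
    have hnhds : {ζ : C(Plane, ℝ) | ∀ x ∈ μ.support, dist (η x) (ζ x) < ε'} ∈ 𝓝 η :=
      Metric.tendstoUniformlyOn_iff.1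
        (ContinuousMap.tendsto_iff_forall_isCompact_tendstoUniformlyOn.1
          (tendsto_id (x := 𝓝 η)) _ hK) ε' hε'0
    obtain ⟨n, hζ⟩ := (TopologicalSpace.denseRange_denseSeq C(Plane, ℝ)).exists_mem_open
      isOpen_interior ⟨η, mem_interior_iff_mem_nhds.2 hnhds⟩
    exact ⟨n, fun x hx => by simpa [Real.dist_eq] using (interior_subset hζ x hx).le⟩
  set ζ := TopologicalSpace.denseSeq C(Plane, ℝ) n with hζ
  have hdiff : ∀ (m : Measure Plane) [IsFiniteMeasure m], (∀ᵐ x ∂m, x ∈ μ.support) →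
      |∫ x, η x ∂m - ∫ x, ζ x ∂m| ≤ ε' * m.real Set.univ := fun m _ hm => by
    rw [← integral_sub (η.continuous.integrable_of_ae_mem_isCompact hK hm)
      (ζ.continuous.integrable_of_ae_mem_isCompact hK hm)]
    exact norm_integral_le_of_norm_le_const (f := fun x => η x - ζ x) (hm.mono hn)
  have hlast : |∫ x, η x ∂densitySlice μ t - ∫ x, ζ x ∂densitySlice μ t| ≤ ε' * N :=
    hdiff _ (h3.mono fun x hx => hx.1)
  have hεN : ε' * (N + 1) = ε / 4 := by rw [hε']; field_simp
  filter_upwards [Metric.tendsto_nhds.1 (h1 n) (ε / 4) (by positivity),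
    h2.eventually_lt_const (lt_add_one N), self_mem_nhdsWithin] with δ hδ1 hδ2 hδ
  have hδ : (0 : ℝ) < δ := hδ
  have hmid := hdiff (μ.restrict ((fun x : Plane => x 1) ⁻¹' Set.Ioo (t - δ) (t + δ)))
    (ae_restrict_of_ae hμK')
  set A := ∫ x in (fun x : Plane => x 1) ⁻¹' Set.Ioo (t - δ) (t + δ), η x ∂μ
  set B := ∫ x in (fun x : Plane => x 1) ⁻¹' Set.Ioo (t - δ) (t + δ), ζ x ∂μ
  set M := (μ.restrict ((fun x : Plane => x 1) ⁻¹' Set.Ioo (t - δ) (t + δ))).real Set.univ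
  rw [Real.dist_eq] at hδ1 ⊢
  have hmid' : |(2 * δ)⁻¹ * A - (2 * δ)⁻¹ * B| ≤ ε / 4 := by
    rw [← mul_sub, abs_mul, abs_of_pos (by positivity : 0 < (2 * δ)⁻¹)]
    calc (2 * δ)⁻¹ * |A - B| ≤ (2 * δ)⁻¹ * (ε' * M) := by gcongr
      _ = ε' * ((2 * δ)⁻¹ * M) := by ring
      _ ≤ ε' * (N + 1) := by gcongr
      _ = ε / 4 := hεN
  have hlast' : ε' * N ≤ ε / 4 := by rw [← hεN]; gcongr; linarith
  rw [abs_le] at hmid' hlast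
  rw [abs_lt] at hδ1 ⊢
  constructor <;> linarith [hmid'.1, hmid'.2, hlast.1, hlast.2, hδ1.1, hδ1.2]

theorem ae_slicedMeasure_eq (μ : Measure Plane) [IsFiniteMeasure μ] (hK : IsCompact μ.support) :
    ∀ᵐ t : ℝ, slicedMeasure μ (fun x => x 1) t = densitySlice μ t :=
  (ae_isSlicedMeasure_densitySlice μ hK).mono fun _ h => h.slicedMeasure_eq

/-! ### Strip averages and Plancherel in the height. -/

/-- The oscillation `e^{-i a x₀}` integrated over a horizontal strip, normalised by its width. -/
noncomputable def stripAverage (μ : Measure Plane) (a δ t : ℝ) : ℂ :=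
  (((2 * δ)⁻¹ : ℝ) : ℂ) * ∫ x in (fun x : Plane => x 1) ⁻¹' Set.Ioo (t - δ) (t + δ),
    Complex.exp (-(Complex.I * ((a * x 0 : ℝ) : ℂ))) ∂μ

/-- The integrand of `stripAverage` on the product space. -/
noncomputable def stripKernel (a δ : ℝ) : ℝ × Plane → ℂ :=
  {p : ℝ × Plane | p.2 1 ∈ Set.Ioo (p.1 - δ) (p.1 + δ)}.indicator
    fun p => Complex.exp (-(Complex.I * ((a * p.2 0 : ℝ) : ℂ)))

theorem measurableSet_strip (δ : ℝ) :
    MeasurableSet {p : ℝ × Plane | p.2 1 ∈ Set.Ioo (p.1 - δ) (p.1 + δ)} :=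
  (measurableSet_lt (f := fun p : ℝ × Plane => p.1 - δ) (g := fun p => p.2 1)
    (by fun_prop) (by fun_prop)).inter (measurableSet_lt (f := fun p : ℝ × Plane => p.2 1)
      (g := fun p => p.1 + δ) (by fun_prop) (by fun_prop))

theorem stripAverage_eq (μ : Measure Plane) (a δ t : ℝ) :
    stripAverage μ a δ t = (((2 * δ)⁻¹ : ℝ) : ℂ) * ∫ x, stripKernel a δ (t, x) ∂μ := by
  rw [stripAverage, ← integral_indicator ((by fun_prop : Measurable fun x : Plane => x 1)
    measurableSet_Ioo)]
  rfl

/-- For fixed `x` the admissible heights form an interval of length `2δ`, so the strip has finite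
product measure. -/
theorem integrable_stripKernel (μ : Measure Plane) [IsFiniteMeasure μ] (a δ : ℝ) :
    Integrable (stripKernel a δ) ((volume : Measure ℝ).prod μ) := by
  rw [stripKernel, integrable_indicator_iff (measurableSet_strip δ)]
  refine Measure.integrableOn_of_bounded (M := 1) ?_
    (Continuous.aestronglyMeasurable (by fun_prop)) (.of_forall fun p => (norm_cexp_neg_I_mul _).le)
  rw [Measure.prod_apply_symm (measurableSet_strip δ)]
  have : ∀ y : Plane, volume ((fun x : ℝ => (x, y)) ⁻¹'
      {p : ℝ × Plane | p.2 1 ∈ Set.Ioo (p.1 - δ) (p.1 + δ)}) = ENNReal.ofReal (2 * δ) := fun y => by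
    have : (fun x : ℝ => (x, y)) ⁻¹' {p : ℝ × Plane | p.2 1 ∈ Set.Ioo (p.1 - δ) (p.1 + δ)} =
        Set.Ioo (y 1 - δ) (y 1 + δ) := by
      ext x
      simp only [Set.mem_preimage, Set.mem_ofPred_eq, Set.mem_Ioo]
      constructor <;> rintro ⟨h1, h2⟩ <;> constructor <;> linarith
    rw [this, Real.volume_Ioo]
    congr 1
    ring
  simp_rw [this, lintegral_const]
  exact ENNReal.mul_ne_top ENNReal.ofReal_ne_top (measure_ne_top _ _)

theorem measurable_stripAverage (μ : Measure Plane) [IsFiniteMeasure μ] (a δ : ℝ) :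
    Measurable (stripAverage μ a δ) := by
  have h : stripAverage μ a δ = fun t => (((2 * δ)⁻¹ : ℝ) : ℂ) * ∫ x, stripKernel a δ (t, x) ∂μ :=
    funext fun t => stripAverage_eq μ a δ t
  rw [h]
  refine (StronglyMeasurable.integral_prod_right' (f := stripKernel a δ) ?_).measurable.const_mul _
  exact (Continuous.stronglyMeasurable (by fun_prop)).indicator (measurableSet_strip δ)

theorem integrable_stripAverage (μ : Measure Plane) [IsFiniteMeasure μ] (a δ : ℝ) :
    Integrable (stripAverage μ a δ) := by
  have h : stripAverage μ a δ = fun t => (((2 * δ)⁻¹ : ℝ) : ℂ) * ∫ x, stripKernel a δ (t, x) ∂μ :=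
    funext fun t => stripAverage_eq μ a δ t
  rw [h]
  exact (integrable_stripKernel μ a δ).integral_prod_left.const_mul _

theorem norm_stripAverage_le (μ : Measure Plane) [IsFiniteMeasure μ] (a δ t : ℝ) :
    ‖stripAverage μ a δ t‖ ≤ ‖(2 * δ)⁻¹‖ * μ.real Set.univ := by
  rw [stripAverage, norm_mul, Complex.norm_real]
  gcongr
  refine (norm_integral_le_of_norm_le_const
    (.of_forall fun x => (norm_cexp_neg_I_mul _).le)).trans ?_
  rw [one_mul, measureReal_restrict_apply_univ]
  exact measureReal_mono (Set.subset_univ _)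

theorem memLp_two_stripAverage (μ : Measure Plane) [IsFiniteMeasure μ] (a δ : ℝ) :
    MemLp (stripAverage μ a δ) 2 := by
  have h := integrable_stripAverage μ a δ
  rw [memLp_two_iff_integrable_sq_norm h.aestronglyMeasurable]
  simp_rw [sq]
  refine h.norm.mul_bdd (c := ‖(2 * δ)⁻¹‖ * μ.real Set.univ) h.norm.aestronglyMeasurable
    (.of_forall fun t => ?_)
  rw [norm_norm]
  exact norm_stripAverage_le μ a δ t

/-- Strip averaging is convolution in `t` with a normalised indicator, whose Fourier transform has
modulus at most 1. The `2π` comes from the convention for `𝓕`. -/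
theorem enorm_fourier_stripAverage_le (μ : Measure Plane) [IsFiniteMeasure μ] (a : ℝ) {δ : ℝ}
    (hδ : 0 < δ) (b : ℝ) :
    ‖𝓕 (stripAverage μ a δ) b‖ₑ ≤ ‖measureFourier μ !₂[a, 2 * Real.pi * b]‖ₑ := by
  set e : ℝ → ℂ := fun u => Complex.exp (-(Complex.I * (u : ℂ))) with he
  have hec : Continuous e := by fun_prop
  have hen : ∀ u, ‖e u‖ = 1 := norm_cexp_neg_I_mul
  have hadd : ∀ u v, e (u + v) = e u * e v := fun u v => by
    simp only [he]
    rw [← Complex.exp_add]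
    congr 1
    push_cast
    ring
  set κ : ℂ := ∫ u in Set.Ioo (-δ) δ, e (2 * Real.pi * b * u) with hκ
  have hκn : ‖κ‖ ≤ 2 * δ := by
    refine (norm_setIntegral_le_of_norm_le_const (C := 1) (by simp) (fun u _ => (hen _).le)).trans ?_
    rw [one_mul, Real.volume_real_Ioo_of_le (by linarith)]
    linarith
  have hinner : ∀ x : Plane, ∫ t, e (2 * Real.pi * b * t) * stripKernel a δ (t, x) =
      κ * e (inner ℝ !₂[a, 2 * Real.pi * b] x) := fun x => by
    -- Centring the window at height `x 1` leaves the phase at `x` times `κ`, which no longer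
    -- depends on `x`.
    rw [← integral_add_right_eq_self _ (x 1), hκ, ← integral_indicator measurableSet_Ioo,
      ← integral_mul_const]
    refine integral_congr_ae (.of_forall fun u => ?_)
    have hinn : inner ℝ !₂[a, 2 * Real.pi * b] x = a * x 0 + 2 * Real.pi * b * x 1 := by
      simp [PiLp.inner_apply, Fin.sum_univ_two]
      ring
    by_cases hu : u ∈ Set.Ioo (-δ) δ
    · have hs : (u + x 1, x) ∈ {p : ℝ × Plane | p.2 1 ∈ Set.Ioo (p.1 - δ) (p.1 + δ)} :=
        ⟨show u + x 1 - δ < x 1 by linarith [hu.2], show x 1 < u + x 1 + δ by linarith [hu.1]⟩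
      simp only [stripKernel, Set.indicator_of_mem hs, Set.indicator_of_mem hu]
      rw [hinn, hadd, mul_add, hadd]
      change _ * e (a * x 0) = _
      ring
    · have hs : (u + x 1, x) ∉ {p : ℝ × Plane | p.2 1 ∈ Set.Ioo (p.1 - δ) (p.1 + δ)} := fun h => by
        have h1 : u + x 1 - δ < x 1 := h.1
        have h2 : x 1 < u + x 1 + δ := h.2
        exact hu ⟨by linarith, by linarith⟩
      simp only [stripKernel, Set.indicator_of_notMem hs, Set.indicator_of_notMem hu, mul_zero,
        zero_mul]
  have hmain : 𝓕 (stripAverage μ a δ) b =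
      (((2 * δ)⁻¹ : ℝ) : ℂ) * (κ * measureFourier μ !₂[a, 2 * Real.pi * b]) := by
    rw [Real.fourier_eq']
    have h1 : ∀ t : ℝ, Complex.exp ((-2 * Real.pi * inner ℝ t b : ℝ) * Complex.I) •
        stripAverage μ a δ t = (((2 * δ)⁻¹ : ℝ) : ℂ) *
          ∫ x, e (2 * Real.pi * b * t) * stripKernel a δ (t, x) ∂μ := fun t => by
      rw [stripAverage_eq, integral_const_mul, smul_eq_mul, mul_left_comm]
      congr 3
      simp
      ring
    rw [integral_congr_ae (.of_forall h1), integral_const_mul, integral_integral_swap]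
    · rw [integral_congr_ae (.of_forall hinner), integral_const_mul]
      rfl
    · exact (integrable_stripKernel μ a δ).bdd_mul (c := 1)
        (Continuous.aestronglyMeasurable (by fun_prop)) (.of_forall fun p => (hen _).le)
  rw [hmain, ← mul_assoc, enorm_mul]
  refine mul_le_of_le_one_left zero_le ?_
  rw [← ofReal_norm, ENNReal.ofReal_le_one, norm_mul, Complex.norm_real, Real.norm_eq_abs,
    abs_of_pos (by positivity), inv_mul_le_iff₀ (by positivity), mul_one]
  exact hκn

/-- The bound is uniform in `δ`, as Fatou requires; rescaling `2πb` to `b` yields `(2π)⁻¹`. -/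
theorem lintegral_stripAverage_sq_le (μ : Measure Plane) [IsFiniteMeasure μ] (a : ℝ) {δ : ℝ}
    (hδ : 0 < δ) :
    ∫⁻ t, ‖stripAverage μ a δ t‖ₑ ^ 2 ≤
      ENNReal.ofReal (2 * Real.pi)⁻¹ * ∫⁻ b, ‖measureFourier μ !₂[a, b]‖ₑ ^ 2 := by
  rw [← lintegral_enorm_fourier_sq (integrable_stripAverage μ a δ) (memLp_two_stripAverage μ a δ)]
  calc _ ≤ ∫⁻ b : ℝ, ‖measureFourier μ !₂[a, 2 * Real.pi * b]‖ₑ ^ 2 :=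
        lintegral_mono fun b => pow_le_pow_left' (enorm_fourier_stripAverage_le μ a hδ b) 2
    _ = ∫⁻ b : ℝ, ‖measureFourier μ !₂[a, b]‖ₑ ^ 2 ∂(volume.map (2 * Real.pi * ·)) :=
        ((Homeomorph.mulLeft₀ (2 * Real.pi) (by positivity)).measurableEmbedding.lintegral_map
          fun b => ‖measureFourier μ !₂[a, b]‖ₑ ^ 2).symm
    _ = _ := by
        rw [Real.map_volume_mul_left (by positivity), lintegral_smul_measure,
          abs_of_pos (by positivity), smul_eq_mul]

theorem IsSlicedMeasure.tendsto_stripAverage {μ : Measure Plane} [IsFiniteMeasure μ] {t : ℝ}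
    {ν : Measure Plane} (h : IsSlicedMeasure μ (fun x => x 1) t ν) (a : ℝ) :
    Tendsto (fun δ => stripAverage μ a δ t) (𝓝[>] 0)
      (𝓝 (∫ x, Complex.exp (-(Complex.I * ((a * x 0 : ℝ) : ℂ))) ∂ν)) := by
  have := h.isFiniteMeasure
  have hint : ∀ (m : Measure Plane) [IsFiniteMeasure m],
      Integrable (fun x : Plane => Complex.exp (-(Complex.I * ((a * x 0 : ℝ) : ℂ)))) m := fun m _ =>
    Integrable.of_bound (C := 1) (Continuous.aestronglyMeasurable (by fun_prop))
      (.of_forall fun x => (norm_cexp_neg_I_mul _).le)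
  have hre := h.tendsto_integral
    ⟨fun x => (Complex.exp (-(Complex.I * ((a * x 0 : ℝ) : ℂ)))).re, by fun_prop⟩
  have him := h.tendsto_integral
    ⟨fun x => (Complex.exp (-(Complex.I * ((a * x 0 : ℝ) : ℂ)))).im, by fun_prop⟩
  have key : ∀ (m : Measure Plane) [IsFiniteMeasure m],
      ∫ x, Complex.exp (-(Complex.I * ((a * x 0 : ℝ) : ℂ))) ∂m =
      ((∫ x, (Complex.exp (-(Complex.I * ((a * x 0 : ℝ) : ℂ)))).re ∂m : ℝ) : ℂ) +
      ((∫ x, (Complex.exp (-(Complex.I * ((a * x 0 : ℝ) : ℂ)))).im ∂m : ℝ) : ℂ) * Complex.I :=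
    fun m _ => (integral_re_add_im (hint m)).symm
  rw [key]
  refine (((Complex.continuous_ofReal.tendsto _).comp hre).add
    (((Complex.continuous_ofReal.tendsto _).comp him).mul_const Complex.I)).congr fun δ => ?_
  simp only [Function.comp, stripAverage, ContinuousMap.coe_mk]
  rw [key]
  push_cast
  ring

/-- Fatou along `δ = 1/(n+1)`: pointwise convergence at a.e. height is enough, and no finiteness of
the right side is needed. -/
theorem lintegral_slice_fourier_sq_le {μ : Measure Plane} [IsFiniteMeasure μ]
    (hK : IsCompact μ.support) (a : ℝ) :
    ∫⁻ t, ‖∫ x, Complex.exp (-(Complex.I * ((a * x 0 : ℝ) : ℂ))) ∂densitySlice μ t‖ₑ ^ 2 ≤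
      ENNReal.ofReal (2 * Real.pi)⁻¹ * ∫⁻ b, ‖measureFourier μ !₂[a, b]‖ₑ ^ 2 := by
  have hseq : Tendsto (fun n : ℕ => 1 / ((n : ℝ) + 1)) atTop (𝓝[>] 0) :=
    tendsto_nhdsWithin_iff.2 ⟨tendsto_one_div_add_atTop_nhds_zero_nat,
      .of_forall fun n => by simpa using by positivity⟩
  calc _ = ∫⁻ t, liminf (fun n : ℕ => ‖stripAverage μ a (1 / ((n : ℝ) + 1)) t‖ₑ ^ 2) atTop := by
        refine lintegral_congr_ae ?_
        filter_upwards [ae_isSlicedMeasure_densitySlice μ hK] with t ht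
        exact ((ENNReal.continuous_pow 2).tendsto _ |>.comp
          ((ht.tendsto_stripAverage a).comp hseq).enorm).liminf_eq.symm
    _ ≤ liminf (fun n : ℕ => ∫⁻ t, ‖stripAverage μ a (1 / ((n : ℝ) + 1)) t‖ₑ ^ 2) atTop :=
        lintegral_liminf_le fun n => (measurable_stripAverage μ a _).enorm.pow_const 2
    _ ≤ _ := by
        refine (liminf_le_liminf (.of_forall fun n =>
          lintegral_stripAverage_sq_le μ a (by positivity))).trans ?_
        simp

/-! ### Measurability, reduction to the line, and assembly. -/

theorem measurable_slice_fourier (μ : Measure Plane) [IsFiniteMeasure μ] :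
    Measurable fun p : ℝ × ℝ =>
      ∫ x, Complex.exp (-(Complex.I * ((p.2 * x 0 : ℝ) : ℂ))) ∂densitySlice μ p.1 := by
  simp only [densitySlice, integral_smul_measure]
  refine ((measurable_heightDensity μ).comp measurable_fst).ennreal_toReal.smul ?_
  exact (StronglyMeasurable.integral_kernel_prod_right
    (κ := (heightKernel μ).comap Prod.fst measurable_fst)
    (f := fun (p : ℝ × ℝ) (x : Plane) => Complex.exp (-(Complex.I * ((p.2 * x 0 : ℝ) : ℂ))))
    (Continuous.stronglyMeasurable (by unfold Function.uncurry; fun_prop))).measurable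

theorem measurable_rieszEnergy_densitySlice (μ : Measure Plane) [IsFiniteMeasure μ] (s : ℝ) :
    Measurable fun t => rieszEnergy s (densitySlice μ t) := by
  simp only [rieszEnergy, densitySlice, lintegral_smul_measure, smul_eq_mul]
  have h1 : Measurable fun p : ℝ × Plane => ∫⁻ y, edist p.2 y ^ (-s) ∂heightKernel μ p.1 :=
    Measurable.lintegral_kernel_prod_right
      (κ := (heightKernel μ).comap Prod.fst measurable_fst)
      (f := fun (p : ℝ × Plane) (y : Plane) => edist p.2 y ^ (-s))
      (((measurable_snd.comp measurable_fst).edist measurable_snd).pow_const _)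
  exact (measurable_heightDensity μ).mul (Measurable.lintegral_kernel_prod_right
    (f := fun (t : ℝ) (x : Plane) => heightDensity μ t * ∫⁻ y, edist x y ^ (-s) ∂heightKernel μ t)
    (((measurable_heightDensity μ).comp measurable_fst).mul h1))

/-- On a horizontal line distances are those of the first coordinates, so projection preserves the
energy. -/
theorem rieszEnergy_eq_of_horizontal {ν : Measure Plane} [IsFiniteMeasure ν] {t : ℝ}
    (h : ∀ᵐ x ∂ν, x 1 = t) {s : ℝ} (hs0 : 0 < s) (hs1 : s < 1) :
    rieszEnergy s ν * ENNReal.ofReal (Real.Gamma (s / 2)) =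
      ENNReal.ofReal ((4 * Real.pi) ^ (-(1 / 2) : ℝ) * 4 ^ ((1 - s) / 2) *
        Real.Gamma ((1 - s) / 2)) *
      ∫⁻ a : ℝ, ‖a‖ₑ ^ (s - 1) *
        ‖∫ x, Complex.exp (-(Complex.I * ((a * x 0 : ℝ) : ℂ))) ∂ν‖ₑ ^ 2 := by
  have hm : Measurable fun x : Plane => x 0 := by fun_prop
  have hline := line_energy_eq hs0 hs1 (ν.map fun x : Plane => x 0)
  have hk : Measurable fun p : ℝ × ℝ => ‖p.1 - p.2‖ₑ ^ (-s) := by fun_prop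
  have h1 : rieszEnergy s ν =
      ∫⁻ x, ∫⁻ y, ‖x - y‖ₑ ^ (-s) ∂(ν.map fun x : Plane => x 0) ∂(ν.map fun x : Plane => x 0) := by
    rw [lintegral_map hk.lintegral_prod_right' hm]
    refine lintegral_congr_ae (h.mono fun x hx => ?_)
    simp only
    rw [lintegral_map (by fun_prop) hm]
    refine lintegral_congr_ae (h.mono fun y hy => ?_)
    simp only
    congr 1
    rw [EuclideanSpace.edist_eq, Fin.sum_univ_two, hx, hy, edist_self]
    rw [← edist_eq_enorm_sub, zero_pow two_ne_zero, add_zero, ← ENNReal.rpow_natCast,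
      ← ENNReal.rpow_mul]
    norm_num
  have h2 : ∀ a, lineFourier (ν.map fun x : Plane => x 0) a =
      ∫ x, Complex.exp (-(Complex.I * ((a * x 0 : ℝ) : ℂ))) ∂ν := fun a =>
    integral_map hm.aemeasurable (Continuous.aestronglyMeasurable (by fun_prop))
  rw [h1, hline]
  simp_rw [h2]

theorem measurable_measureFourier (μ : Measure Plane) [IsFiniteMeasure μ] :
    Measurable (measureFourier μ) :=
  (StronglyMeasurable.integral_prod_right' (f := fun p : Plane × Plane =>
    Complex.exp (-(Complex.I * (inner ℝ p.1 p.2 : ℝ))))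
      (Continuous.stronglyMeasurable (by fun_prop))).measurable

theorem lintegral_plane {F : Plane → ℝ≥0∞} (hF : Measurable F) :
    ∫⁻ x, F x = ∫⁻ a : ℝ, ∫⁻ b : ℝ, F !₂[a, b] := by
  have h1 := (PiLp.volume_preserving_ofLp (Fin 2)).symm (MeasurableEquiv.toLp 2 (Fin 2 → ℝ)).symm
  have h2 := (volume_preserving_finTwoArrow ℝ).symm MeasurableEquiv.finTwoArrow
  rw [← (h1.comp h2).lintegral_comp hF]
  rw [Measure.volume_eq_prod, lintegral_prod]
  · rfl
  · exact (hF.comp (h1.comp h2).measurable).aemeasurable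

theorem mainTheorem6 (d : ℝ) (hd₁ : 1 < d) (hd₂ : d < 2) :
    ∃ C : ℝ≥0, 0 < C ∧
      ∀ (μ : Measure Plane) [μ.Regular], IsCompact μ.support →
        (∀ᵐ t : ℝ, IsSlicedMeasure μ (fun x => x 1) t (slicedMeasure μ (fun x => x 1) t)) ∧
        AEMeasurable (fun t : ℝ => rieszEnergy (d - 1) (slicedMeasure μ (fun x => x 1) t)) ∧
        ∫⁻ t : ℝ, rieszEnergy (d - 1) (slicedMeasure μ (fun x => x 1) t) ≤
          C * ∫⁻ x : Plane, ‖x 0‖ₑ ^ (d - 2) * ‖measureFourier μ x‖ₑ ^ 2 := by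
  have hs0 : 0 < d - 1 := by linarith
  have hs1 : d - 1 < 1 := by linarith
  set k₁ : ℝ := Real.Gamma ((d - 1) / 2) with hk₁
  set k₂ : ℝ := (4 * Real.pi) ^ (-(1 / 2) : ℝ) * 4 ^ ((1 - (d - 1)) / 2) *
    Real.Gamma ((1 - (d - 1)) / 2) with hk₂
  have hk₁0 : 0 < k₁ := Real.Gamma_pos_of_pos (by linarith)
  have hk₂0 : 0 < k₂ := by
    have : 0 < Real.Gamma ((1 - (d - 1)) / 2) := Real.Gamma_pos_of_pos (by linarith)
    positivity
  -- `k₂ / k₁` is the constant of the energy identity on the line, and `(2π)⁻¹` the one from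
  -- Plancherel in the height.
  refine ⟨(k₂ / k₁ * (2 * Real.pi)⁻¹).toNNReal, by simpa using by positivity, fun μ _ hK => ?_⟩
  have := isFiniteMeasure_of_isCompact_support μ hK
  have hslice := ae_isSlicedMeasure_densitySlice μ hK
  have heq := ae_slicedMeasure_eq μ hK
  refine ⟨?_, ?_, ?_⟩
  · filter_upwards [hslice, heq] with t h1 h2
    rwa [h2]
  -- Slices are picked by choice, so measurability comes from the a.e. equal family built on the
  -- kernel; a.e. measurability for Lebesgue measure is Lebesgue measurability.
  · exact (measurable_rieszEnergy_densitySlice μ (d - 1)).aemeasurable.congr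
      (heq.mono fun t ht => by simp only [ht])
  set F : ℝ → ℝ → ℂ := fun t a =>
    ∫ x, Complex.exp (-(Complex.I * ((a * x 0 : ℝ) : ℂ))) ∂densitySlice μ t with hF
  have hFm : Measurable fun p : ℝ × ℝ => F p.1 p.2 := measurable_slice_fourier μ
  have hFm' : ∀ a, Measurable fun t => F t a := fun a =>
    hFm.comp (measurable_id.prodMk measurable_const)
  have hμm := measurable_measureFourier μ
  have henergy : ∀ᵐ t : ℝ, rieszEnergy (d - 1) (slicedMeasure μ (fun x => x 1) t) =
      ENNReal.ofReal (k₂ / k₁) * ∫⁻ a : ℝ, ‖a‖ₑ ^ (d - 2) * ‖F t a‖ₑ ^ 2 := by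
    filter_upwards [hslice, heq,
      ae_densitySlice_mem μ hK.measurableSet Measure.measure_compl_support] with t h1 h2 h3
    have := h1.isFiniteMeasure
    have h4 := rieszEnergy_eq_of_horizontal (h3.mono fun x hx => hx.2) hs0 hs1
    rw [h2, ENNReal.ofReal_div_of_pos hk₁0, ENNReal.mul_comm_div, ← mul_div_assoc,
      ENNReal.eq_div_iff (by simpa using hk₁0) ENNReal.ofReal_ne_top, mul_comm, h4,
      show d - 1 - 1 = d - 2 by ring]
  calc ∫⁻ t : ℝ, rieszEnergy (d - 1) (slicedMeasure μ (fun x => x 1) t)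
      = ENNReal.ofReal (k₂ / k₁) * ∫⁻ t : ℝ, ∫⁻ a : ℝ, ‖a‖ₑ ^ (d - 2) * ‖F t a‖ₑ ^ 2 := by
        rw [lintegral_congr_ae henergy, lintegral_const_mul' _ _ ENNReal.ofReal_ne_top]
    _ = ENNReal.ofReal (k₂ / k₁) * ∫⁻ a : ℝ, ‖a‖ₑ ^ (d - 2) * ∫⁻ t : ℝ, ‖F t a‖ₑ ^ 2 := by
        rw [lintegral_lintegral_swap]
        · congr 1
          refine lintegral_congr fun a => ?_
          rw [lintegral_const_mul _ ((hFm' a).enorm.pow_const 2)]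
        · exact (((measurable_snd.enorm).pow_const _).mul (hFm.enorm.pow_const 2)).aemeasurable
    _ ≤ ENNReal.ofReal (k₂ / k₁) * ∫⁻ a : ℝ, ‖a‖ₑ ^ (d - 2) *
          (ENNReal.ofReal (2 * Real.pi)⁻¹ * ∫⁻ b, ‖measureFourier μ !₂[a, b]‖ₑ ^ 2) := by
        gcongr with a
        exact lintegral_slice_fourier_sq_le hK a
    _ = _ := by
        have hpair : ∀ a : ℝ, Measurable fun b : ℝ => (!₂[a, b] : Plane) := fun a => by fun_prop
        rw [lintegral_plane (by fun_prop)]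
        simp_rw [mul_left_comm _ (ENNReal.ofReal (2 * Real.pi)⁻¹)]
        rw [lintegral_const_mul' _ _ ENNReal.ofReal_ne_top, ← mul_assoc,
          ← ENNReal.ofReal_mul (by positivity), ENNReal.ofNNReal_toNNReal]
        congr 1
        refine lintegral_congr fun a => ?_
        exact (lintegral_const_mul _ ((hμm.comp (hpair a)).enorm.pow_const 2)).symm
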